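/- Let $\{V_t\}_{t\in\mathbb{Z}}$ be a real-valued, square-integrable, mean-zero, (second-order) stationary time series with autocovariances $\eta_k=\operatorname{cov}(V_t,V_{t+k})$, $k\in\mathbb{Z}$ (so that $\eta_{-k}=\eta_k$). Suppose that $\sum_{k\in\mathbb{Z}}|k|\,|\eta_k|<\infty$ and that the spectral density $f_v(\omega)=(2\pi)^{-1}\sum_{k\in\mathbb{Z}}\eta_k e^{-\iota k\omega}$, where $\iota=\sqrt{-1}$, is positive for every $\omega\in[-\pi,\pi]$. For $T\ge 1$ let $\Lambda_T=(\eta_{s-r})_{r,s=1}^{T}$ be the $T\times T$ Toeplitz autocovariance matrix. For a matrix $A=(a_{ij})\in\mathbb{R}^{m\times n}$ write $\|A\|_1=\max_{j}\sum_{i=1}^m|a_{ij}|$ and $\|A\|_\infty=\max_{i}\sum_{j=1}^n|a_{ij}|$ for the $\ell_1$ and $\ell_\infty$ induced norms. Then $\Lambda_T$ is invertible for every $T\ge1$, and there is a finite constant $C$, not depending on $T$, such that $\|\Lambda_T^{-1}\|_1\le C$ and $\|\Lambda_T^{-1}\|_\infty\le C$ for all $T\ge 1$. -/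

import Mathlib

open MeasureTheory ProbabilityTheory

open scoped ComplexOrder

noncomputable section

/-- A real-valued, square-integrable, centred time series indexed by the integers that is
(second-order) stationary: the covariance of `V t` and `V (t + i)` depends only on the lag `i`. -/
structure IsCenteredStationary {Ω : Type*} [MeasurableSpace Ω] (μ : Measure Ω)
    (V : ℤ → Ω → ℝ) : Prop where
  memLp : ∀ t : ℤ, MemLp (V t) 2 μ
  mean_zero : ∀ t : ℤ, ∫ x, V t x ∂μ = 0
  cov_eq : ∀ s t i : ℤ, covariance (V s) (V (s + i)) μ = covariance (V t) (V (t + i)) μ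

/-- The autocovariance `η_i = cov(V_0, V_i)` of a time series (for a stationary series this is
`cov(V_t, V_{t+i})` for every `t`). -/
def autocov {Ω : Type*} [MeasurableSpace Ω] (μ : Measure Ω) (V : ℤ → Ω → ℝ) (i : ℤ) : ℝ :=
  covariance (V 0) (V i) μ

/-- The spectral density function `f(ω) = (2π)⁻¹ ∑_{i ∈ ℤ} η_i exp(-√-1 i ω)`. -/
def spectralDensity (η : ℤ → ℝ) (ω : ℝ) : ℂ :=
  (2 * (Real.pi : ℂ))⁻¹ * ∑' i : ℤ, (η i : ℂ) * Complex.exp (-Complex.I * (i : ℂ) * (ω : ℂ))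

/-- The `T × T` Toeplitz autocovariance matrix, with `(r, s)` entry `η_{s - r}`. -/
def autocovMatrix (η : ℤ → ℝ) (T : ℕ) : Matrix (Fin T) (Fin T) ℝ :=
  Matrix.of fun r s => η (((s : ℕ) : ℤ) - ((r : ℕ) : ℤ))

/-- The `ℓ₁` induced norm of a matrix: the largest absolute column sum. -/
def matrixL1Norm {m n : ℕ} (A : Matrix (Fin m) (Fin n) ℝ) : ℝ :=
  ⨆ j : Fin n, ∑ i : Fin m, |A i j|

/-- The `ℓ_∞` induced norm of a matrix: the largest absolute row sum. -/
def matrixLInftyNorm {m n : ℕ} (A : Matrix (Fin m) (Fin n) ℝ) : ℝ :=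
  ⨆ i : Fin m, ∑ j : Fin n, |A i j|

end

/-! A positive continuous spectral density has a minimum b > 0 on the compact interval, and Fourier
inversion turns this into coercivity of every Λ_T with constant c = 2πb (`autocovMatrix_coercive`).
This controls the columns of the inverse only in ℓ². For ℓ¹ decay, commute Λ_T with the position
operator D: the commutator has entries of size |i-j||η_{j-i}|, so by the Schur test its norm is at
most K = ∑|k||η_k|. Hence column j, weighted by i-j, also has bounded ℓ² norm, and Cauchy–Schwarz
gives an ℓ¹ bound free of T (`sum_abs_inv_le_of_coercive`). -/

/-! ### Coercive matrices and off-diagonal decay of their inverses -/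

open Finset in
/-- Schur test: a matrix whose absolute row and column sums are at most `K` is bounded by `K`
in the Euclidean operator norm. -/
theorem sum_sq_mulVec_le_of_sum_abs_le {n : Type*} [Fintype n] (B : Matrix n n ℝ) {K : ℝ}
    (hrow : ∀ i, ∑ j, |B i j| ≤ K) (hcol : ∀ j, ∑ i, |B i j| ≤ K) (x : n → ℝ) :
    ∑ i, (B.mulVec x i) ^ 2 ≤ K ^ 2 * ∑ j, x j ^ 2 := by
  have hB : ∀ i, (B.mulVec x i) ^ 2 ≤ K * ∑ j, |B i j| * x j ^ 2 := fun i => by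
    have h1 : (∑ j, B i j * x j) ^ 2 ≤ (∑ j, |B i j|) * ∑ j, |B i j| * x j ^ 2 := by
      refine sum_sq_le_sum_mul_sum_of_sq_le_mul _ (fun j _ => abs_nonneg _)
        (fun j _ => by positivity) fun j _ => le_of_eq ?_
      rw [mul_pow, ← sq_abs (B i j)]
      ring
    exact h1.trans (mul_le_mul_of_nonneg_right (hrow i) (sum_nonneg fun j _ => by positivity))
  calc ∑ i, (B.mulVec x i) ^ 2 ≤ ∑ i, K * ∑ j, |B i j| * x j ^ 2 := sum_le_sum fun i _ => hB i
    _ = K * ∑ j, (∑ i, |B i j|) * x j ^ 2 := by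
      rw [← mul_sum, sum_comm]
      simp_rw [sum_mul]
    _ ≤ K * ∑ j, K * x j ^ 2 := by
      rcases isEmpty_or_nonempty n with h | ⟨⟨a⟩⟩
      · simp
      · have hK : 0 ≤ K := (sum_nonneg fun j _ => abs_nonneg _).trans (hrow a)
        gcongr with j
        exact hcol j
    _ = K ^ 2 * ∑ j, x j ^ 2 := by rw [← mul_sum]; ring

open Finset in
/-- A coercive matrix is bounded below in the Euclidean norm. -/
theorem sum_sq_le_sum_sq_mulVec_of_coercive {n : Type*} [Fintype n] (A : Matrix n n ℝ) {c : ℝ}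
    (hc : 0 < c) (hA : ∀ x : n → ℝ, c * ∑ i, x i ^ 2 ≤ ∑ i, x i * A.mulVec x i) (x : n → ℝ) :
    c ^ 2 * ∑ i, x i ^ 2 ≤ ∑ i, (A.mulVec x i) ^ 2 := by
  have h0 : 0 ≤ ∑ i, x i ^ 2 := sum_nonneg fun i _ => sq_nonneg _
  -- Cauchy–Schwarz gives the claim multiplied by `∑ x i ^ 2`, which cancels only when nonzero.
  rcases h0.eq_or_lt with h | h
  · rw [← h, mul_zero]
    exact sum_nonneg fun i _ => sq_nonneg _
  · have h1 := sum_mul_sq_le_sq_mul_sq univ x (A.mulVec x)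
    have h2 : (c * ∑ i, x i ^ 2) ^ 2 ≤ (∑ i, x i * A.mulVec x i) ^ 2 :=
      pow_le_pow_left₀ (by positivity) (hA x) 2
    refine le_of_mul_le_mul_left ?_ h
    calc (∑ i, x i ^ 2) * (c ^ 2 * ∑ i, x i ^ 2) = (c * ∑ i, x i ^ 2) ^ 2 := by ring
      _ ≤ _ := h2.trans h1

theorem isUnit_of_coercive {n : Type*} [Fintype n] [DecidableEq n] (A : Matrix n n ℝ) {c : ℝ}
    (hc : 0 < c) (hA : ∀ x : n → ℝ, c * ∑ i, x i ^ 2 ≤ ∑ i, x i * A.mulVec x i) :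
    IsUnit A := by
  rw [← Matrix.mulVec_injective_iff_isUnit]
  refine (injective_iff_map_eq_zero A.mulVecLin).2 fun x hx => ?_
  have hx' : A.mulVec x = 0 := hx
  have h := hA x
  simp only [hx', Pi.zero_apply, mul_zero, Finset.sum_const_zero] at h
  have h0 : ∑ i, x i ^ 2 = 0 :=
    le_antisymm (by nlinarith) (Finset.sum_nonneg fun i _ => sq_nonneg _)
  funext i
  simpa using (Finset.sum_eq_zero_iff_of_nonneg fun i _ => sq_nonneg (x i)).1 h0 i

theorem summable_inv_one_add_int_sq : Summable fun k : ℤ => (1 + (k : ℝ) ^ 2)⁻¹ := by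
  refine (Real.summable_one_div_int_pow.2 one_lt_two).of_norm_bounded_eventually ?_
  refine (Set.finite_singleton (0 : ℤ)).subset fun k hk => ?_
  by_contra hne
  have hk0 : (0 : ℝ) < (k : ℝ) ^ 2 := by
    have : (k : ℝ) ≠ 0 := by exact_mod_cast hne
    positivity
  refine hk ?_
  rw [Set.mem_ofPred_eq, Real.norm_of_nonneg (by positivity), ← one_div]
  exact one_div_le_one_div_of_le hk0 (by linarith)

/-- Along a row or column the lags are distinct, so a finite sum over them is bounded by the full
series, uniformly in T. -/
theorem sum_comp_le_tsum {ι κ : Type*} [Fintype ι] {g : κ → ℝ} (hg : Summable g)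
    (h0 : ∀ k, 0 ≤ g k) {e : ι → κ} (he : Function.Injective e) :
    ∑ i, g (e i) ≤ ∑' k, g k := by
  have := hg.sum_le_tsum (Finset.univ.map ⟨e, he⟩) fun k _ => h0 k
  rwa [Finset.sum_map] at this

open Finset in
/-- The columns of the inverse of a coercive matrix with a bounded commutator with the position
operator are uniformly summable. -/
theorem sum_abs_inv_le_of_coercive {T : ℕ} (A : Matrix (Fin T) (Fin T) ℝ) {c K : ℝ}
    (hc : 0 < c) (hA : ∀ x : Fin T → ℝ, c * ∑ i, x i ^ 2 ≤ ∑ i, x i * A.mulVec x i)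
    (hrow : ∀ i : Fin T, ∑ j : Fin T, |(i : ℝ) - (j : ℝ)| * |A i j| ≤ K)
    (hcol : ∀ j : Fin T, ∑ i : Fin T, |(i : ℝ) - (j : ℝ)| * |A i j| ≤ K) (j : Fin T) :
    ∑ i, |A⁻¹ i j| ≤
      √((∑' k : ℤ, (1 + (k : ℝ) ^ 2)⁻¹) * ((c ^ 2)⁻¹ + K ^ 2 * (c ^ 2)⁻¹ ^ 2)) := by
  set S := ∑' k : ℤ, (1 + (k : ℝ) ^ 2)⁻¹
  have hdet : IsUnit A.det := (Matrix.isUnit_iff_isUnit_det A).1 (isUnit_of_coercive A hc hA)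
  set x : Fin T → ℝ := fun i => A⁻¹ i j
  set y : Fin T → ℝ := fun i => ((i : ℝ) - (j : ℝ)) * x i
  have hAx : ∀ i, A.mulVec x i = (1 : Matrix (Fin T) (Fin T) ℝ) i j := fun i => by
    rw [← Matrix.mul_nonsing_inv A hdet]
    rfl
  -- With y = (D - j)x and Ax = e_j, the term (D - j)Ax vanishes, leaving Ay = [A, D]x.
  have hAy : A.mulVec y =
      (Matrix.of fun i k : Fin T => ((k : ℝ) - (i : ℝ)) * A i k).mulVec x := by
    funext i
    have h : ((i : ℝ) - (j : ℝ)) * A.mulVec x i = 0 := by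
      rw [hAx, Matrix.one_apply]
      split_ifs with hij <;> simp [hij]
    rw [← sub_eq_zero, ← h]
    simp only [Matrix.mulVec, dotProduct, Matrix.of_apply, y]
    rw [← sum_sub_distrib, mul_sum]
    exact sum_congr rfl fun k _ => by ring
  have hx2 : ∑ i, x i ^ 2 ≤ (c ^ 2)⁻¹ := by
    have h := sum_sq_le_sum_sq_mulVec_of_coercive A hc hA x
    simp only [hAx, Matrix.one_apply, ite_pow, one_pow, ne_eq, OfNat.ofNat_ne_zero,
      not_false_eq_true, zero_pow, sum_ite_eq', mem_univ, if_true] at h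
    rwa [← one_div, le_div_iff₀' (by positivity)]
  have hy2 : ∑ i, y i ^ 2 ≤ K ^ 2 * (c ^ 2)⁻¹ ^ 2 := by
    have h := sum_sq_le_sum_sq_mulVec_of_coercive A hc hA y
    rw [hAy] at h
    have h' := h.trans (sum_sq_mulVec_le_of_sum_abs_le _ (K := K)
      (fun i => by simpa [abs_mul, abs_sub_comm] using hrow i)
      (fun k => by simpa [abs_mul, abs_sub_comm] using hcol k) x)
    have h'' := h'.trans (mul_le_mul_of_nonneg_left hx2 (sq_nonneg K))
    calc ∑ i, y i ^ 2 = (c ^ 2)⁻¹ * (c ^ 2 * ∑ i, y i ^ 2) := by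
          rw [inv_mul_cancel_left₀ (by positivity)]
      _ ≤ (c ^ 2)⁻¹ * (K ^ 2 * (c ^ 2)⁻¹) := mul_le_mul_of_nonneg_left h'' (by positivity)
      _ = _ := by ring
  refine Real.le_sqrt_of_sq_le ?_
  -- The weight 1 + (i-j)² splits the second factor into ‖x‖² + ‖y‖², and its inverse is summable
  -- over ℤ.
  have hCS : (∑ i, |x i|) ^ 2 ≤ (∑ i : Fin T, (1 + ((i : ℝ) - (j : ℝ)) ^ 2)⁻¹) *
      ∑ i : Fin T, (1 + ((i : ℝ) - (j : ℝ)) ^ 2) * x i ^ 2 := by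
    refine sum_sq_le_sum_mul_sum_of_sq_le_mul _ (fun i _ => by positivity)
      (fun i _ => by positivity) fun i _ => le_of_eq ?_
    rw [inv_mul_cancel_left₀ (by positivity), sq_abs]
  have hS : ∑ i : Fin T, (1 + ((i : ℝ) - (j : ℝ)) ^ 2)⁻¹ ≤ S := by
    have := sum_comp_le_tsum summable_inv_one_add_int_sq (fun k => by positivity)
      (e := fun i : Fin T => (i : ℤ) - (j : ℤ)) fun a b h => by
        simpa [Fin.ext_iff] using h
    simpa using this
  refine hCS.trans (mul_le_mul hS ?_ (sum_nonneg fun i _ => by positivity)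
    (tsum_nonneg fun k => by positivity))
  calc ∑ i : Fin T, (1 + ((i : ℝ) - (j : ℝ)) ^ 2) * x i ^ 2
      = ∑ i, x i ^ 2 + ∑ i, y i ^ 2 := by
        rw [← sum_add_distrib]
        exact sum_congr rfl fun i _ => by simp only [y]; ring
    _ ≤ _ := add_le_add hx2 hy2

/-! ### Fourier inversion for the spectral density -/

theorem summable_abs_of_summable_abs_mul {η : ℤ → ℝ}
    (h : Summable fun i : ℤ => |(i : ℝ)| * |η i|) : Summable fun i => |η i| := by
  -- The comparison |η_k| ≤ |k||η_k| can fail only at k = 0.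
  refine h.of_norm_bounded_eventually ((Set.finite_singleton (0 : ℤ)).subset fun k hk => ?_)
  by_contra hne
  refine hk ?_
  have h1 : (1 : ℝ) ≤ |(k : ℝ)| := by exact_mod_cast Int.one_le_abs hne
  rw [Set.mem_ofPred_eq, Real.norm_of_nonneg (abs_nonneg _)]
  exact le_mul_of_one_le_left (abs_nonneg _) h1

theorem norm_fourierTerm (η : ℤ → ℝ) (i : ℤ) (ω : ℝ) :
    ‖(η i : ℂ) * Complex.exp (-Complex.I * (i : ℂ) * (ω : ℂ))‖ = |η i| := by
  rw [norm_mul, Complex.norm_real, Real.norm_eq_abs]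
  have : -Complex.I * (i : ℂ) * (ω : ℂ) = ((-(i * ω) : ℝ) : ℂ) * Complex.I := by
    push_cast; ring
  rw [this, Complex.norm_exp_ofReal_mul_I, mul_one]

theorem continuous_spectralDensity {η : ℤ → ℝ} (h : Summable fun i => |η i|) :
    Continuous (spectralDensity η) := by
  refine continuous_const.mul (continuous_tsum (fun i => by fun_prop) h fun i ω => ?_)
  exact (norm_fourierTerm η i ω).le

theorem integral_exp_int_mul_I (m : ℤ) :
    ∫ ω in (-Real.pi)..Real.pi, Complex.exp (Complex.I * (m : ℂ) * (ω : ℂ)) =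
      if m = 0 then 2 * (Real.pi : ℂ) else 0 := by
  split_ifs with hm
  · subst hm
    simp
    ring
  · rw [integral_exp_mul_complex (by simpa using hm), div_eq_zero_iff, sub_eq_zero]
    left
    rw [Complex.exp_eq_exp_iff_exists_int]
    exact ⟨m, by push_cast; ring⟩

/-- Fourier inversion for the spectral density. -/
theorem integral_spectralDensity_mul_exp {η : ℤ → ℝ} (h : Summable fun i => |η i|) (m : ℤ) :
    ∫ ω in (-Real.pi)..Real.pi,
      spectralDensity η ω * Complex.exp (Complex.I * (m : ℂ) * (ω : ℂ)) = (η m : ℂ) := by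
  have hterm : ∀ (i : ℤ) (ω : ℝ), (η i : ℂ) * Complex.exp (-Complex.I * (i : ℂ) * (ω : ℂ)) *
      Complex.exp (Complex.I * (m : ℂ) * (ω : ℂ)) =
      (η i : ℂ) * Complex.exp (Complex.I * ((m - i : ℤ) : ℂ) * (ω : ℂ)) := fun i ω => by
    rw [mul_assoc, ← Complex.exp_add]
    congr 2
    push_cast
    ring
  have hnorm : ∀ (i : ℤ) (ω : ℝ),
      ‖(η i : ℂ) * Complex.exp (Complex.I * ((m - i : ℤ) : ℂ) * (ω : ℂ))‖ = |η i| :=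
    fun i ω => by
      rw [← norm_fourierTerm η i ω, norm_mul, norm_mul]
      congr 1
      have h1 : Complex.I * ((m - i : ℤ) : ℂ) * (ω : ℂ)
          = (((m - i) * ω : ℝ) : ℂ) * Complex.I := by push_cast; ring
      have h2 : -Complex.I * (i : ℂ) * (ω : ℂ) = ((-(i * ω) : ℝ) : ℂ) * Complex.I := by
        push_cast; ring
      rw [h1, h2, Complex.norm_exp_ofReal_mul_I, Complex.norm_exp_ofReal_mul_I]
  have key := intervalIntegral.hasSum_integral_of_dominated_convergence
    (μ := volume) (a := -Real.pi) (b := Real.pi)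
    (F := fun (i : ℤ) (ω : ℝ) =>
      (η i : ℂ) * Complex.exp (Complex.I * ((m - i : ℤ) : ℂ) * (ω : ℂ)))
    (f := fun ω => ∑' i : ℤ, (η i : ℂ) * Complex.exp (Complex.I * ((m - i : ℤ) : ℂ) * (ω : ℂ)))
    (fun i _ => |η i|) (fun i => (by fun_prop : Continuous _).aestronglyMeasurable)
    (fun i => .of_forall fun ω _ => (hnorm i ω).le) (.of_forall fun _ _ => h)
    intervalIntegrable_const
    (.of_forall fun ω _ => (Summable.of_norm (by simpa only [hnorm] using h)).hasSum)
  have h2 : HasSum (fun i : ℤ => ∫ ω in (-Real.pi)..Real.pi,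
      (η i : ℂ) * Complex.exp (Complex.I * ((m - i : ℤ) : ℂ) * (ω : ℂ)))
      ((η m : ℂ) * (2 * (Real.pi : ℂ))) := by
    convert hasSum_ite_eq m ((η m : ℂ) * (2 * (Real.pi : ℂ))) using 2 with i
    rw [intervalIntegral.integral_const_mul, integral_exp_int_mul_I]
    by_cases hi : i = m
    · simp [hi]
    · simp [hi, sub_eq_zero, Ne.symm hi]
  have hpi : (2 * (Real.pi : ℂ)) ≠ 0 := by simp [Real.pi_ne_zero]
  simp_rw [spectralDensity, mul_assoc (2 * (Real.pi : ℂ))⁻¹, ← tsum_mul_right, hterm]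
  rw [intervalIntegral.integral_const_mul, key.unique h2]
  field_simp

theorem integral_re_spectralDensity_mul_cos {η : ℤ → ℝ} (h : Summable fun i => |η i|)
    (hre : ∀ ω ∈ Set.Icc (-Real.pi) Real.pi, (spectralDensity η ω).im = 0) (m : ℤ) :
    ∫ ω in (-Real.pi)..Real.pi, (spectralDensity η ω).re * Real.cos (m * ω) = η m := by
  have hpi : -Real.pi ≤ Real.pi := by linarith [Real.pi_pos]
  have hint : IntervalIntegrable (fun ω : ℝ =>
      spectralDensity η ω * Complex.exp (Complex.I * (m : ℂ) * (ω : ℂ))) volume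
      (-Real.pi) Real.pi :=
    ((continuous_spectralDensity h).mul (by fun_prop)).intervalIntegrable _ _
  have h1 := congrArg Complex.re (integral_spectralDensity_mul_exp h m)
  rw [← Complex.reCLM_apply, ← Complex.reCLM.intervalIntegral_comp_comm hint,
    Complex.ofReal_re] at h1
  rw [← h1]
  refine intervalIntegral.integral_congr fun ω hω => ?_
  rw [Set.uIcc_of_le hpi] at hω
  have h2 : Complex.I * (m : ℂ) * (ω : ℂ) = ((m * ω : ℝ) : ℂ) * Complex.I := by
    push_cast; ring
  simp only [Complex.reCLM_apply, Complex.mul_re, hre ω hω, zero_mul, sub_zero, h2,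
    Complex.exp_ofReal_mul_I_re]

/-! ### Coercivity of the autocovariance matrices -/

open Finset in
-- The double sum is |∑ x_r e^{iθ_r}|².
theorem sum_mul_cos_sub_nonneg {ι : Type*} [Fintype ι] (x θ : ι → ℝ) :
    0 ≤ ∑ r, ∑ s, x r * x s * Real.cos (θ s - θ r) := by
  have h : ∑ r, ∑ s, x r * x s * Real.cos (θ s - θ r) =
      (∑ r, x r * Real.cos (θ r)) ^ 2 + (∑ r, x r * Real.sin (θ r)) ^ 2 := by
    rw [sq, sq, sum_mul_sum, sum_mul_sum, ← sum_add_distrib]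
    refine sum_congr rfl fun r _ => ?_
    rw [← sum_add_distrib]
    exact sum_congr rfl fun s _ => by rw [Real.cos_sub]; ring
  rw [h]
  positivity

theorem integral_cos_int_mul (m : ℤ) :
    ∫ ω in (-Real.pi)..Real.pi, Real.cos (m * ω) = if m = 0 then 2 * Real.pi else 0 := by
  split_ifs with hm
  · subst hm
    simp
    ring
  · have hm' : (m : ℝ) ≠ 0 := by exact_mod_cast hm
    rw [intervalIntegral.integral_comp_mul_left _ hm']
    simp [Real.sin_int_mul_pi]

open Finset in
/-- A lower bound on the spectral density is a lower bound on the autocovariance matrices. -/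
theorem autocovMatrix_coercive {η : ℤ → ℝ} (h : Summable fun i => |η i|)
    (hre : ∀ ω ∈ Set.Icc (-Real.pi) Real.pi, (spectralDensity η ω).im = 0) {b : ℝ}
    (hb : ∀ ω ∈ Set.Icc (-Real.pi) Real.pi, b ≤ (spectralDensity η ω).re)
    (T : ℕ) (x : Fin T → ℝ) :
    2 * Real.pi * b * ∑ i, x i ^ 2 ≤ ∑ i, x i * (autocovMatrix η T).mulVec x i := by
  have hpi : -Real.pi ≤ Real.pi := by linarith [Real.pi_pos]
  have hcont : Continuous fun ω => (spectralDensity η ω).re :=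
    Complex.continuous_re.comp (continuous_spectralDensity h)
  let d : Fin T → Fin T → ℤ := fun r s => ((s : ℕ) : ℤ) - ((r : ℕ) : ℤ)
  let P : ℝ → ℝ := fun ω => ∑ r, ∑ s, x r * x s * Real.cos (d r s * ω)
  have hP : ∀ ω, 0 ≤ P ω := fun ω => by
    have := sum_mul_cos_sub_nonneg x fun r => (r : ℕ) * ω
    simpa [P, d, sub_mul] using this
  have hint : ∀ g : ℝ → ℝ, Continuous g → ∫ ω in (-Real.pi)..Real.pi, g ω * P ω =
      ∑ r, ∑ s, x r * x s * ∫ ω in (-Real.pi)..Real.pi, g ω * Real.cos (d r s * ω) := by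
    intro g hg
    have : ∀ ω, g ω * P ω = ∑ r, ∑ s, x r * x s * (g ω * Real.cos (d r s * ω)) := fun ω => by
      simp only [P, mul_sum]
      exact sum_congr rfl fun r _ => sum_congr rfl fun s _ => by ring
    simp_rw [this]
    rw [intervalIntegral.integral_finsetSum
      fun r _ => (by fun_prop : Continuous _).intervalIntegrable _ _]
    refine sum_congr rfl fun r _ => ?_
    rw [intervalIntegral.integral_finsetSum
      fun s _ => (by fun_prop : Continuous _).intervalIntegrable _ _]
    exact sum_congr rfl fun s _ => intervalIntegral.integral_const_mul _ _
  -- Orthogonality of the cosines leaves only the diagonal r = s.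
  have hL : ∫ ω in (-Real.pi)..Real.pi, b * P ω = 2 * Real.pi * b * ∑ i, x i ^ 2 := by
    rw [hint _ continuous_const, mul_sum]
    refine sum_congr rfl fun r _ => ?_
    rw [sum_eq_single r]
    · rw [intervalIntegral.integral_const_mul, integral_cos_int_mul]
      simp [d]
      ring
    · intro s _ hs
      have : d r s ≠ 0 := by
        simp only [d]
        have := Fin.val_ne_of_ne hs
        omega
      rw [intervalIntegral.integral_const_mul, integral_cos_int_mul, if_neg this]
      simp
    · simp
  have hR : ∫ ω in (-Real.pi)..Real.pi, (spectralDensity η ω).re * P ω =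
      ∑ i, x i * (autocovMatrix η T).mulVec x i := by
    rw [hint _ hcont]
    refine sum_congr rfl fun r _ => ?_
    rw [Matrix.mulVec, dotProduct, mul_sum]
    refine sum_congr rfl fun s _ => ?_
    rw [integral_re_spectralDensity_mul_cos h hre, autocovMatrix, Matrix.of_apply]
    ring
  have hPc : Continuous P := by fun_prop
  rw [← hL, ← hR]
  exact intervalIntegral.integral_mono_on hpi
    ((continuous_const.mul hPc).intervalIntegrable _ _)
    ((hcont.mul hPc).intervalIntegrable _ _)
    fun ω hω => mul_le_mul_of_nonneg_right (hb ω hω) (hP ω)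

open Finset in
theorem exists_bound_inv_autocovMatrix {η : ℤ → ℝ}
    (hsum : Summable fun i : ℤ => |(i : ℝ)| * |η i|)
    (hpos : ∀ ω ∈ Set.Icc (-Real.pi) Real.pi, 0 < spectralDensity η ω) :
    ∃ C : ℝ, 0 ≤ C ∧ ∀ T : ℕ, IsUnit (autocovMatrix η T) ∧
      (∀ j, ∑ i, |(autocovMatrix η T)⁻¹ i j| ≤ C) ∧
      ∀ i, ∑ j, |(autocovMatrix η T)⁻¹ i j| ≤ C := by
  have h := summable_abs_of_summable_abs_mul hsum
  obtain ⟨ω₀, hω₀, hmin⟩ := isCompact_Icc.exists_isMinOn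
    (⟨0, by constructor <;> linarith [Real.pi_pos]⟩ :
      (Set.Icc (-Real.pi) Real.pi).Nonempty)
    (Complex.continuous_re.comp (continuous_spectralDensity h)).continuousOn
  have hb0 : 0 < (spectralDensity η ω₀).re := (Complex.pos_iff.1 (hpos ω₀ hω₀)).1
  obtain ⟨c, hcdef⟩ : ∃ c, c = 2 * Real.pi * (spectralDensity η ω₀).re := ⟨_, rfl⟩
  have hc : 0 < c := by rw [hcdef]; positivity
  have hA : ∀ (T : ℕ) (x : Fin T → ℝ),
      c * ∑ i, x i ^ 2 ≤ ∑ i, x i * (autocovMatrix η T).mulVec x i := by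
    rw [hcdef]
    exact autocovMatrix_coercive h (fun ω hω => (Complex.pos_iff.1 (hpos ω hω)).2.symm)
      (fun ω hω => hmin hω)
  have hg0 : ∀ k : ℤ, 0 ≤ |(k : ℝ)| * |η k| := fun k => by positivity
  refine ⟨√((∑' k : ℤ, (1 + (k : ℝ) ^ 2)⁻¹) *
    ((c ^ 2)⁻¹ + (∑' k : ℤ, |(k : ℝ)| * |η k|) ^ 2 * (c ^ 2)⁻¹ ^ 2)),
    Real.sqrt_nonneg _, fun T => ?_⟩
  have hrow : ∀ i : Fin T, ∑ j : Fin T, |(i : ℝ) - (j : ℝ)| * |autocovMatrix η T i j| ≤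
      ∑' k : ℤ, |(k : ℝ)| * |η k| := fun i => by
    have := sum_comp_le_tsum hsum hg0 (e := fun j : Fin T => ((j : ℕ) : ℤ) - ((i : ℕ) : ℤ))
      fun a b hab => by simpa [Fin.ext_iff] using hab
    simpa [autocovMatrix, abs_sub_comm (i : ℝ)] using this
  have hcol : ∀ j : Fin T, ∑ i : Fin T, |(i : ℝ) - (j : ℝ)| * |autocovMatrix η T i j| ≤
      ∑' k : ℤ, |(k : ℝ)| * |η k| := fun j => by
    have := sum_comp_le_tsum hsum hg0 (e := fun i : Fin T => ((j : ℕ) : ℤ) - ((i : ℕ) : ℤ))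
      fun a b hab => by simpa [Fin.ext_iff] using hab
    simpa [autocovMatrix, abs_sub_comm _ (j : ℝ)] using this
  refine ⟨isUnit_of_coercive _ hc (hA T), sum_abs_inv_le_of_coercive _ hc (hA T) hrow hcol, ?_⟩
  intro i
  -- Rows of the inverse are columns of the inverse of the transpose; transposing keeps the
  -- quadratic form and swaps `hrow` with `hcol`.
  have := sum_abs_inv_le_of_coercive (autocovMatrix η T).transpose hc
    (fun x => (hA T x).trans_eq ?_)
    (fun i => by simpa [abs_sub_comm] using hcol i)
    (fun j => by simpa [abs_sub_comm] using hrow j) i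
  · simpa [← Matrix.transpose_nonsing_inv] using this
  · simp only [Matrix.mulVec, dotProduct, mul_sum, Matrix.transpose_apply]
    rw [sum_comm]
    exact sum_congr rfl fun r _ => sum_congr rfl fun s _ => by ring

theorem mainTheorem3 {Ω : Type*} [MeasurableSpace Ω] (μ : Measure Ω) [IsProbabilityMeasure μ]
    (V : ℤ → Ω → ℝ) (hV : IsCenteredStationary μ V)
    (hsum : Summable fun i : ℤ => |(i : ℝ)| * |autocov μ V i|)
    (hpos : ∀ ω ∈ Set.Icc (-Real.pi) Real.pi, 0 < spectralDensity (autocov μ V) ω) :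
    ∃ C : ℝ, ∀ T : ℕ, 1 ≤ T →
      IsUnit (autocovMatrix (autocov μ V) T) ∧
      matrixL1Norm (autocovMatrix (autocov μ V) T)⁻¹ ≤ C ∧
      matrixLInftyNorm (autocovMatrix (autocov μ V) T)⁻¹ ≤ C := by
  obtain ⟨C, hC, h⟩ := exists_bound_inv_autocovMatrix hsum hpos
  exact ⟨C, fun T _ => ⟨(h T).1, Real.iSup_le (h T).2.1 hC, Real.iSup_le (h T).2.2 hC⟩⟩
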